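/- For $\xi\in\mathbb{R}$ let $\operatorname{Erf}(\xi)=\int_0^\xi e^{-x^2}\,dx$, and for an integer $d\ge 1$ let \[ V_d=\int_{[0,1]^d}\int_{[0,1]^d}\frac{dy\,dx}{\|x-y\|_2}\in[0,\infty] \] be the self-interaction of the unit $d$-cube. (i) For all $d\ge 1$, \[ V_d=\frac{2}{\sqrt\pi}\int_0^\infty\left(\frac{2\operatorname{Erf}(\sigma)}{\sigma}+\frac{e^{-\sigma^2}-1}{\sigma^2}\right)^{d}d\sigma . \] For $d=1$ both sides are $+\infty$; for $d\ge 2$ both sides are finite, and the integrand on the right is integrable on $(0,\infty)$. (ii) For $d=4$, the function $\sigma^{-1}e^{-\sigma^2}\operatorname{Erf}(\sigma)^3$ is integrable on $(0,\infty)$ and \[ \begin{aligned} V_4={}&-\frac{152}{315}+\frac{68\sqrt2}{105}-\frac{16\sqrt3}{35}-\frac{16\log 2}{5}+\frac{2\log 3}{5} +\frac45\log(1+\sqrt2)+\frac{32}{5}\log(1+\sqrt3)\\ &-\frac{8\pi}{15}-\frac{8\sqrt2}{5}\arctan\frac{1}{2\sqrt2} -\frac{16}{3}\cdot\frac{2}{\sqrt\pi}\int_0^\infty\sigma^{-1}e^{-\sigma^2}\operatorname{Erf}(\sigma)^3\,d\sigma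 . \end{aligned} \] -/

import Mathlib

open MeasureTheory Set
open scoped ENNReal

noncomputable section

/-- The error function normalized as the odd primitive of the Gaussian `exp (-x ^ 2)`
(without the factor `2 / √π`). -/
def Erf (ξ : ℝ) : ℝ := ∫ x in (0 : ℝ)..ξ, Real.exp (-x ^ 2)

/-- The unit cube `[0,1]^d` in Euclidean space `ℝ^d`. -/
def unitCube (d : ℕ) : Set (EuclideanSpace ℝ (Fin d)) :=
  {x | ∀ i, x i ∈ Icc (0 : ℝ) 1}

/-- The Newtonian self-interaction `V_d = ∫_{[0,1]^d} ∫_{[0,1]^d} dy dx / ‖x - y‖₂` of the unit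
`d`-cube. The integrand is nonnegative, so the integral is taken with values in `[0, ∞]`; the
integrand is `∞` on the diagonal. -/
def selfInteraction (d : ℕ) : ℝ≥0∞ :=
  ∫⁻ x in unitCube d, ∫⁻ y in unitCube d, (ENNReal.ofReal ‖x - y‖)⁻¹

end

/-!
The Gaussian formula `1 / r = 2 / √π * ∫₀^∞ exp (-r² σ²) dσ` turns the kernel `1 / ‖x - y‖` into a
superposition of products over the coordinates, so the double integral over the cube becomes, for
each `σ`, the `d`-th power of the corresponding double integral over the interval. That power decays
like `σ⁻ᵈ`, which decides finiteness.

For `d = 4`, expand the power into moments `∫ σ⁻ᵐ Erf(σ)ᵃ (1 - exp (-σ²))ᵇ exp (-σ²)ᶜ dσ`.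
Integration by parts lowers `m` at the cost of raising `c`, and every moment that occurs reduces to
moments with `m ≤ 1` and `b = 0`. Writing `Erf σ = σ ∫₀¹ exp (-(t σ)²) dt` and exchanging the
integrals evaluates all of these except `∫ σ⁻¹ exp (-σ²) Erf(σ)³ dσ`.
-/

section

open Filter Topology Real

variable {σ : ℝ}

theorem integral_exp_neg_sq (a b : ℝ) : ∫ x in a..b, exp (-x ^ 2) = Erf b - Erf a := by
  have hi (u v : ℝ) : IntervalIntegrable (fun x : ℝ => exp (-x ^ 2)) volume u v :=
    Continuous.intervalIntegrable (by fun_prop) u v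
  exact (intervalIntegral.integral_interval_sub_left (hi 0 b) (hi 0 a)).symm

theorem hasDerivAt_Erf (ξ : ℝ) : HasDerivAt Erf (exp (-ξ ^ 2)) ξ :=
  (by fun_prop : Continuous fun x : ℝ => exp (-x ^ 2)).integral_hasStrictDerivAt 0 ξ |>.hasDerivAt

@[fun_prop]
theorem continuous_Erf : Continuous Erf :=
  continuous_iff_continuousAt.2 fun ξ => (hasDerivAt_Erf ξ).continuousAt

@[simp]
theorem Erf_zero : Erf 0 = 0 := by simp [Erf]

@[simp]
theorem Erf_neg (ξ : ℝ) : Erf (-ξ) = -Erf ξ := by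
  have h := intervalIntegral.integral_comp_neg (a := 0) (b := ξ) fun x : ℝ => exp (-x ^ 2)
  simp only [neg_sq, neg_zero, integral_exp_neg_sq, Erf_zero] at h
  linarith

theorem monotone_Erf : Monotone Erf :=
  monotone_of_hasDerivAt_nonneg hasDerivAt_Erf fun _ => (exp_pos _).le

theorem Erf_nonneg (hσ : 0 ≤ σ) : 0 ≤ Erf σ := by
  simpa using monotone_Erf hσ

theorem tendsto_Erf_atTop : Tendsto Erf atTop (𝓝 (√π / 2)) := by
  have hi : IntegrableOn (fun x : ℝ => exp (-x ^ 2)) (Ioi 0) := by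
    simpa using (integrable_exp_neg_mul_sq one_pos).integrableOn
  have hlim := intervalIntegral_tendsto_integral_Ioi 0 hi tendsto_id
  have hval : ∫ x in Ioi (0 : ℝ), exp (-x ^ 2) = √π / 2 := by
    simpa using integral_gaussian_Ioi 1
  rwa [hval] at hlim

theorem Erf_le_one (ξ : ℝ) : Erf ξ ≤ 1 := by
  have hpi : √π ≤ 2 := sqrt_le_iff.2 ⟨by norm_num, by linarith [pi_le_four]⟩
  linarith [monotone_Erf.ge_of_tendsto tendsto_Erf_atTop ξ]

theorem Erf_eq_mul_integral (σ : ℝ) : Erf σ = σ * ∫ t in (0 : ℝ)..1, exp (-(t * σ) ^ 2) := by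
  rw [intervalIntegral.mul_integral_comp_mul_right (f := fun x : ℝ => exp (-x ^ 2)), zero_mul,
    one_mul, Erf]

theorem Erf_le_self (hσ : 0 ≤ σ) : Erf σ ≤ σ := by
  have h : Erf σ ≤ ∫ _ in (0 : ℝ)..σ, (1 : ℝ) :=
    intervalIntegral.integral_mono_on hσ (Continuous.intervalIntegrable (by fun_prop) _ _)
      (by simp) fun x _ => exp_le_one_iff.2 (by nlinarith)
  simpa using h

theorem integral_Erf (a b : ℝ) :
    ∫ x in a..b, Erf x = (b * Erf b + exp (-b ^ 2) / 2) - (a * Erf a + exp (-a ^ 2) / 2) := by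
  refine intervalIntegral.integral_eq_sub_of_hasDerivAt
    (f := fun x => x * Erf x + exp (-x ^ 2) / 2) (fun x _ => ?_)
    (continuous_Erf.intervalIntegrable a b)
  have hexp : HasDerivAt (fun x : ℝ => exp (-x ^ 2)) (exp (-x ^ 2) * -(2 * x)) x := by
    simpa using (hasDerivAt_pow 2 x).neg.exp
  refine (((hasDerivAt_id x).mul (hasDerivAt_Erf x)).add (hexp.div_const 2)).congr_deriv ?_
  simp only [id_eq]
  ring

/-- The Gaussian self-interaction `∫∫ exp (-(σ (x - y))²) dy dx` of the unit interval, in the closed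
form that appears in the integral representation of `selfInteraction`; at `σ = 0` division by zero
makes it `0`, whereas the double integral is `1`. -/
noncomputable def gaussianInteraction (σ : ℝ) : ℝ :=
  2 * Erf σ / σ + (exp (-σ ^ 2) - 1) / σ ^ 2

theorem integral_exp_neg_sq_mul_sub (hσ : σ ≠ 0) (x : ℝ) :
    ∫ y in (0 : ℝ)..1, exp (-(σ * (x - y)) ^ 2) = σ⁻¹ * (Erf (σ * x) - Erf (σ * x - σ)) := by
  simp only [mul_sub]
  rw [intervalIntegral.integral_comp_sub_mul (fun u => exp (-u ^ 2)) hσ, integral_exp_neg_sq]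
  simp only [smul_eq_mul, mul_zero, mul_one, sub_zero, mul_sub]

theorem integral_integral_exp_neg_sq_mul_sub (hσ : σ ≠ 0) :
    ∫ x in (0 : ℝ)..1, ∫ y in (0 : ℝ)..1, exp (-(σ * (x - y)) ^ 2) = gaussianInteraction σ := by
  simp only [integral_exp_neg_sq_mul_sub hσ]
  rw [intervalIntegral.integral_const_mul, intervalIntegral.integral_sub
    (Continuous.intervalIntegrable (by fun_prop) _ _)
    (Continuous.intervalIntegrable (by fun_prop) _ _),
    intervalIntegral.integral_comp_mul_left Erf hσ, intervalIntegral.integral_comp_mul_sub Erf hσ,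
    integral_Erf, integral_Erf]
  simp only [gaussianInteraction, smul_eq_mul, mul_one, mul_zero, sub_self, zero_sub, Erf_neg,
    neg_sq, Erf_zero]
  norm_num
  field_simp
  ring

theorem gaussianInteraction_nonneg (hσ : σ ≠ 0) : 0 ≤ gaussianInteraction σ := by
  rw [← integral_integral_exp_neg_sq_mul_sub hσ]
  exact intervalIntegral.integral_nonneg zero_le_one fun _ _ =>
    intervalIntegral.integral_nonneg zero_le_one fun _ _ => (exp_pos _).le

theorem gaussianInteraction_le (hσ : 0 < σ) : gaussianInteraction σ ≤ 2 * min 1 σ⁻¹ := by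
  have hexp : (exp (-σ ^ 2) - 1) / σ ^ 2 ≤ 0 :=
    div_nonpos_of_nonpos_of_nonneg (sub_nonpos.2 (exp_le_one_iff.2 (by simp [sq_nonneg])))
      (sq_nonneg σ)
  have hErf : Erf σ / σ ≤ min 1 σ⁻¹ :=
    le_min ((div_le_one hσ).2 (Erf_le_self hσ.le))
      (by simpa using div_le_div_of_nonneg_right (Erf_le_one σ) hσ.le)
  rw [gaussianInteraction, mul_div_assoc]
  linarith

theorem continuousOn_gaussianInteraction : ContinuousOn gaussianInteraction (Ioi 0) := by
  unfold gaussianInteraction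
  refine ContinuousOn.add (ContinuousOn.div (by fun_prop) (by fun_prop) fun σ hσ => ne_of_gt hσ)
    (ContinuousOn.div (by fun_prop) (by fun_prop) fun σ hσ => pow_ne_zero 2 (ne_of_gt hσ))

theorem integrableOn_min_one_inv_pow {n : ℕ} (hn : 2 ≤ n) :
    IntegrableOn (fun σ : ℝ => min 1 σ⁻¹ ^ n) (Ioi 0) := by
  refine (integrable_inv_one_add_sq.const_mul 2).integrableOn.mono' (by fun_prop)
    ((ae_restrict_mem measurableSet_Ioi).mono fun σ (hσ : 0 < σ) => ?_)
  have hmin : 0 ≤ min 1 σ⁻¹ := by positivity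
  have hone : min 1 σ⁻¹ ^ 2 ≤ 1 := pow_le_one₀ hmin (min_le_left _ _)
  have hinv : σ ^ 2 * min 1 σ⁻¹ ^ 2 ≤ 1 := by
    rw [← mul_pow]
    refine pow_le_one₀ (by positivity) ?_
    exact (mul_le_mul_of_nonneg_left (min_le_right _ _) hσ.le).trans_eq (mul_inv_cancel₀ hσ.ne')
  calc ‖min 1 σ⁻¹ ^ n‖ = min 1 σ⁻¹ ^ n := norm_of_nonneg (by positivity)
    _ ≤ min 1 σ⁻¹ ^ 2 := pow_le_pow_of_le_one hmin (min_le_left _ _) hn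
    _ ≤ 2 * (1 + σ ^ 2)⁻¹ := by
      rw [← div_eq_mul_inv, le_div_iff₀ (by positivity)]
      linarith

theorem integrableOn_gaussianInteraction_pow {d : ℕ} (hd : 2 ≤ d) :
    IntegrableOn (fun σ => gaussianInteraction σ ^ d) (Ioi 0) := by
  refine ((integrableOn_min_one_inv_pow hd).const_mul (2 ^ d)).mono'
    ((continuousOn_gaussianInteraction.pow d).aestronglyMeasurable measurableSet_Ioi)
    ((ae_restrict_mem measurableSet_Ioi).mono fun σ (hσ : 0 < σ) => ?_)
  have h0 := gaussianInteraction_nonneg hσ.ne'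
  rw [norm_of_nonneg (pow_nonneg h0 d), ← mul_pow]
  exact pow_le_pow_left₀ h0 (gaussianInteraction_le hσ) d

theorem tendsto_mul_gaussianInteraction_atTop :
    Tendsto (fun σ => σ * gaussianInteraction σ) atTop (𝓝 (√π)) := by
  have hexp : Tendsto (fun σ : ℝ => exp (-σ ^ 2)) atTop (𝓝 0) :=
    tendsto_exp_neg_atTop_nhds_zero.comp (tendsto_pow_atTop two_ne_zero)
  have h := (tendsto_Erf_atTop.const_mul 2).add
    ((hexp.sub_const 1).mul (tendsto_inv_atTop_zero (𝕜 := ℝ)))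
  rw [mul_zero, add_zero, mul_div_cancel₀ _ two_ne_zero] at h
  refine h.congr' ?_
  filter_upwards [eventually_gt_atTop 0] with σ hσ
  rw [gaussianInteraction]
  field_simp

theorem not_integrableOn_gaussianInteraction : ¬ IntegrableOn gaussianInteraction (Ioi 0) := by
  intro hi
  have hpi : 1 < √π := lt_sqrt_of_sq_lt (by linarith [pi_gt_three])
  obtain ⟨M, hM⟩ := eventually_atTop.1
    (tendsto_mul_gaussianInteraction_atTop.eventually (lt_mem_nhds hpi))
  refine not_integrableOn_Ioi_inv (a := max 0 M) ?_
  refine (hi.mono_set (Ioi_subset_Ioi (le_max_left 0 M))).mono' (by fun_prop)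
    ((ae_restrict_mem measurableSet_Ioi).mono fun σ hσ => ?_)
  obtain ⟨h0, hMσ⟩ := max_lt_iff.1 (mem_Ioi.1 hσ)
  rw [norm_of_nonneg (inv_nonneg.2 h0.le), inv_le_iff_one_le_mul₀' h0]
  exact (hM σ hMσ.le).le

/-! ### Gaussian representation of the self-interaction -/

theorem inv_ofReal_eq_lintegral_gaussian {r : ℝ} (hr : 0 ≤ r) :
    (ENNReal.ofReal r)⁻¹ =
      ENNReal.ofReal (2 / √π) * ∫⁻ σ in Ioi (0 : ℝ), ENNReal.ofReal (exp (-r ^ 2 * σ ^ 2)) := by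
  have hc : 0 < 2 / √π := by positivity
  rcases hr.eq_or_lt with rfl | hr
  · simp [ENNReal.mul_top, hc]
  · rw [← ofReal_integral_eq_lintegral_ofReal
      (integrable_exp_neg_mul_sq (pow_pos hr 2)).integrableOn (ae_of_all _ fun σ => (exp_pos _).le),
      integral_gaussian_Ioi, ← ENNReal.ofReal_mul hc.le, ← ENNReal.ofReal_inv_of_pos hr,
      sqrt_div pi_pos.le, sqrt_sq hr.le]
    congr 1
    field_simp

theorem lintegral_pi_ofReal_prod {ι : Type*} [Fintype ι] {α : ι → Type*}
    [∀ i, MeasurableSpace (α i)] (μ : ∀ i, Measure (α i)) [∀ i, SigmaFinite (μ i)]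
    {f : ∀ i, α i → ℝ} (hf : ∀ i, Integrable (f i) (μ i)) (h0 : ∀ i x, 0 ≤ f i x) :
    ∫⁻ x, ENNReal.ofReal (∏ i, f i (x i)) ∂Measure.pi μ =
      ENNReal.ofReal (∏ i, ∫ x, f i x ∂μ i) := by
  rw [← integral_fintype_prod_eq_prod, ofReal_integral_eq_lintegral_ofReal
    (Integrable.fintype_prod_dep hf)
    (ae_of_all _ fun x => Finset.prod_nonneg fun i _ => h0 i (x i))]

theorem lintegral_lintegral_pi_ofReal_prod {ι α β : Type*} [Fintype ι] [MeasurableSpace α]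
    [MeasurableSpace β] (μ : Measure α) (ν : Measure β) [SigmaFinite μ] [SigmaFinite ν]
    {f : α → β → ℝ} (hf : ∀ x, Integrable (f x) ν) (hf' : Integrable (fun x => ∫ y, f x y ∂ν) μ)
    (h0 : ∀ x y, 0 ≤ f x y) :
    ∫⁻ x, ∫⁻ y, ENNReal.ofReal (∏ i : ι, f (x i) (y i)) ∂Measure.pi (fun _ => ν)
        ∂Measure.pi (fun _ => μ) =
      ENNReal.ofReal ((∫ x, ∫ y, f x y ∂ν ∂μ) ^ Fintype.card ι) := by
  have hinner (x : ι → α) :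
      ∫⁻ y, ENNReal.ofReal (∏ i, f (x i) (y i)) ∂Measure.pi (fun _ => ν) =
        ENNReal.ofReal (∏ i, ∫ y, f (x i) y ∂ν) :=
    lintegral_pi_ofReal_prod (fun _ => ν) (fun i => hf (x i)) fun i => h0 (x i)
  simp only [hinner]
  rw [lintegral_pi_ofReal_prod (fun _ => μ) (fun _ => hf')
    fun _ x => integral_nonneg (h0 x), Finset.prod_const, Finset.card_univ]

theorem lintegral_lintegral_lintegral_rotate {α β γ : Type*} [MeasurableSpace α]
    [MeasurableSpace β] [MeasurableSpace γ] (μ : Measure α) (ν : Measure β) (ρ : Measure γ)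
    [SFinite μ] [SFinite ν] [SFinite ρ] {f : α → β → γ → ℝ≥0∞}
    (hf : Measurable fun p : α × β × γ => f p.1 p.2.1 p.2.2) :
    ∫⁻ x, ∫⁻ y, ∫⁻ z, f x y z ∂ρ ∂ν ∂μ = ∫⁻ z, ∫⁻ x, ∫⁻ y, f x y z ∂ν ∂μ ∂ρ := by
  have hinner (x : α) : ∫⁻ y, ∫⁻ z, f x y z ∂ρ ∂ν = ∫⁻ z, ∫⁻ y, f x y z ∂ν ∂ρ :=
    lintegral_lintegral_swap (hf.comp measurable_prodMk_left).aemeasurable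
  have hpartial : Measurable fun p : α × γ => ∫⁻ y, f p.1 y p.2 ∂ν :=
    Measurable.lintegral_prod_right'
      (f := fun q : (α × γ) × β => f q.1.1 q.2 q.1.2)
      (hf.comp (f := fun q : (α × γ) × β => (q.1.1, q.2, q.1.2)) (by fun_prop))
  simp only [hinner]
  exact lintegral_lintegral_swap hpartial.aemeasurable

theorem setLIntegral_unitCube {d : ℕ} (F : EuclideanSpace ℝ (Fin d) → ℝ≥0∞) :
    ∫⁻ x in unitCube d, F x =
      ∫⁻ x, F (WithLp.toLp 2 x) ∂Measure.pi fun _ : Fin d => volume.restrict (Icc (0 : ℝ) 1) := by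
  rw [← (PiLp.volume_preserving_toLp (Fin d)).setLIntegral_comp_preimage_emb
    (MeasurableEquiv.toLp 2 (Fin d → ℝ)).measurableEmbedding F (unitCube d),
    ← Measure.restrict_pi_pi, volume_pi]
  congr 2
  ext x
  simp [unitCube, Pi.le_def, forall_and]

theorem lintegral_lintegral_unitCube_gaussian (d : ℕ) (hσ : σ ≠ 0) :
    ∫⁻ x in unitCube d, ∫⁻ y in unitCube d, ENNReal.ofReal (exp (-‖x - y‖ ^ 2 * σ ^ 2)) =
      ENNReal.ofReal (gaussianInteraction σ ^ d) := by
  have hprod (x y : Fin d → ℝ) :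
      exp (-‖WithLp.toLp 2 x - WithLp.toLp 2 y‖ ^ 2 * σ ^ 2) =
        ∏ i, exp (-(σ * (x i - y i)) ^ 2) := by
    rw [← exp_sum, EuclideanSpace.norm_sq_eq]
    simp [Finset.sum_mul, mul_pow, mul_comm (σ ^ 2)]
  have hinterval (f : ℝ → ℝ) : ∫ x in Icc (0 : ℝ) 1, f x = ∫ x in (0 : ℝ)..1, f x := by
    rw [intervalIntegral.integral_of_le zero_le_one, integral_Icc_eq_integral_Ioc]
  have hcont {f : ℝ → ℝ} (hf : Continuous f) : IntegrableOn f (Icc 0 1) :=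
    hf.continuousOn.integrableOn_compact isCompact_Icc
  have hinner : Continuous fun x => ∫ y in Icc (0 : ℝ) 1, exp (-(σ * (x - y)) ^ 2) := by
    simp only [hinterval, integral_exp_neg_sq_mul_sub hσ]
    fun_prop
  simp only [setLIntegral_unitCube, hprod]
  rw [lintegral_lintegral_pi_ofReal_prod (f := fun x y => exp (-(σ * (x - y)) ^ 2)) _ _
    (fun x => hcont (by fun_prop)) (hcont hinner) fun _ _ => (exp_pos _).le]
  simp only [hinterval, integral_integral_exp_neg_sq_mul_sub hσ, Fintype.card_fin]

theorem selfInteraction_eq_lintegral (d : ℕ) :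
    selfInteraction d =
      ∫⁻ σ in Ioi (0 : ℝ), ENNReal.ofReal (2 / √π * gaussianInteraction σ ^ d) := by
  have hc : 0 ≤ 2 / √π := by positivity
  calc selfInteraction d
      = ENNReal.ofReal (2 / √π) * ∫⁻ x in unitCube d, ∫⁻ y in unitCube d, ∫⁻ σ in Ioi (0 : ℝ),
          ENNReal.ofReal (exp (-‖x - y‖ ^ 2 * σ ^ 2)) := by
        simp only [selfInteraction, inv_ofReal_eq_lintegral_gaussian (norm_nonneg _),
          lintegral_const_mul' _ _ ENNReal.ofReal_ne_top]
    _ = ENNReal.ofReal (2 / √π) * ∫⁻ σ in Ioi (0 : ℝ), ∫⁻ x in unitCube d, ∫⁻ y in unitCube d,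
          ENNReal.ofReal (exp (-‖x - y‖ ^ 2 * σ ^ 2)) := by
        rw [lintegral_lintegral_lintegral_rotate]
        fun_prop
    _ = ENNReal.ofReal (2 / √π) *
          ∫⁻ σ in Ioi (0 : ℝ), ENNReal.ofReal (gaussianInteraction σ ^ d) := by
        rw [setLIntegral_congr_fun measurableSet_Ioi fun σ hσ =>
          lintegral_lintegral_unitCube_gaussian d (ne_of_gt hσ)]
    _ = _ := by
        rw [← lintegral_const_mul' _ _ ENNReal.ofReal_ne_top]
        simp only [ENNReal.ofReal_mul hc]

theorem selfInteraction_one : selfInteraction 1 = ∞ := by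
  rw [selfInteraction_eq_lintegral]
  by_contra hfin
  have hc : 0 < 2 / √π := by positivity
  have hmeas : AEStronglyMeasurable gaussianInteraction (volume.restrict (Ioi 0)) :=
    continuousOn_gaussianInteraction.aestronglyMeasurable measurableSet_Ioi
  rw [← ne_eq, lintegral_ofReal_ne_top_iff_integrable (by simpa using hmeas.const_mul (2 / √π))]
    at hfin
  · simp only [pow_one] at hfin
    exact not_integrableOn_gaussianInteraction
      ((integrable_const_mul_iff (IsUnit.mk0 _ hc.ne') _).1 hfin)
  · filter_upwards [ae_restrict_mem measurableSet_Ioi] with σ hσ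
    exact mul_nonneg hc.le (pow_nonneg (gaussianInteraction_nonneg (ne_of_gt hσ)) 1)

theorem selfInteraction_eq_ofReal {d : ℕ} (hd : 2 ≤ d) :
    selfInteraction d =
      ENNReal.ofReal (2 / √π * ∫ σ in Ioi (0 : ℝ), gaussianInteraction σ ^ d) := by
  rw [selfInteraction_eq_lintegral, ← integral_const_mul, ofReal_integral_eq_lintegral_ofReal
    ((integrableOn_gaussianInteraction_pow hd).const_mul _)]
  filter_upwards [ae_restrict_mem measurableSet_Ioi] with σ hσ
  exact mul_nonneg (by positivity) (pow_nonneg (gaussianInteraction_nonneg (ne_of_gt hσ)) d)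

theorem toReal_selfInteraction {d : ℕ} (hd : 2 ≤ d) :
    (selfInteraction d).toReal = 2 / √π * ∫ σ in Ioi (0 : ℝ), gaussianInteraction σ ^ d := by
  rw [selfInteraction_eq_ofReal hd, ENNReal.toReal_ofReal]
  exact mul_nonneg (by positivity) (setIntegral_nonneg measurableSet_Ioi fun σ hσ =>
    pow_nonneg (gaussianInteraction_nonneg (ne_of_gt hσ)) d)

/-! ### Moments of the error function -/

/-- The monomial `σ⁻ᵐ Erf(σ)ᵃ (1 - exp (-σ²))ᵇ exp (-σ²)ᶜ`. At the origin the factors with exponents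
`m`, `a`, `b`, `c` have orders `-m`, `a`, `2 * b`, `0`. -/
noncomputable def erfMonomial (m a b c : ℕ) (σ : ℝ) : ℝ :=
  σ⁻¹ ^ m * Erf σ ^ a * (1 - exp (-σ ^ 2)) ^ b * exp (-σ ^ 2) ^ c

/-- The moment `∫₀^∞ σ⁻ᵐ Erf(σ)ᵃ (1 - exp (-σ²))ᵇ exp (-σ²)ᶜ dσ`. -/
noncomputable def erfMoment (m a b c : ℕ) : ℝ :=
  ∫ σ in Ioi (0 : ℝ), erfMonomial m a b c σ

theorem continuousOn_erfMonomial (m a b c : ℕ) : ContinuousOn (erfMonomial m a b c) (Ioi 0) := by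
  have hinv : ContinuousOn (fun σ : ℝ => σ⁻¹) (Ioi 0) :=
    continuousOn_inv₀.mono fun _ hσ => ne_of_gt hσ
  unfold erfMonomial
  fun_prop

theorem one_sub_exp_neg_sq_nonneg (σ : ℝ) : 0 ≤ 1 - exp (-σ ^ 2) :=
  sub_nonneg.2 (exp_le_one_iff.2 (neg_nonpos.2 (sq_nonneg σ)))

theorem erfMonomial_nonneg (m a b c : ℕ) (hσ : 0 < σ) : 0 ≤ erfMonomial m a b c σ := by
  have hErf := Erf_nonneg hσ.le
  have hexp := one_sub_exp_neg_sq_nonneg σ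
  unfold erfMonomial
  positivity

theorem erfMonomial_le {m a b : ℕ} (c : ℕ) (h : m ≤ a + 2 * b) (hσ : 0 < σ) :
    erfMonomial m a b c σ ≤ min 1 σ⁻¹ ^ m := by
  have hmin : 0 ≤ min 1 σ := by positivity
  have hErf₀ : 0 ≤ Erf σ := Erf_nonneg hσ.le
  have hErf : Erf σ ≤ min 1 σ := le_min (Erf_le_one σ) (Erf_le_self hσ.le)
  have hexp₀ : 0 ≤ 1 - exp (-σ ^ 2) := one_sub_exp_neg_sq_nonneg σ
  have hexp : 1 - exp (-σ ^ 2) ≤ min 1 σ ^ 2 := by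
    rcases min_choice 1 σ with hm | hm <;> rw [hm]
    · linarith [exp_pos (-σ ^ 2)]
    · linarith [add_one_le_exp (-σ ^ 2)]
  have hexp_le_one : exp (-σ ^ 2) ≤ 1 := sub_nonneg.1 hexp₀
  calc erfMonomial m a b c σ
      ≤ σ⁻¹ ^ m * min 1 σ ^ a * (min 1 σ ^ 2) ^ b * 1 ^ c := by
        unfold erfMonomial
        gcongr
    _ = σ⁻¹ ^ m * min 1 σ ^ (a + 2 * b) := by ring
    _ ≤ σ⁻¹ ^ m * min 1 σ ^ m := by
        gcongr ?_ * ?_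
        exact pow_le_pow_of_le_one hmin (min_le_left 1 σ) h
    _ = min 1 σ⁻¹ ^ m := by
        rw [← mul_pow, mul_min_of_nonneg _ _ (inv_nonneg.2 hσ.le), inv_mul_cancel₀ hσ.ne', mul_one,
          min_comm]

theorem integrableOn_erfMonomial {m a b c : ℕ} (h : m ≤ a + 2 * b) (h' : 2 ≤ m ∨ c ≠ 0) :
    IntegrableOn (erfMonomial m a b c) (Ioi 0) := by
  have of_le {g : ℝ → ℝ} (hg : IntegrableOn g (Ioi 0) volume)
      (hle : ∀ σ > 0, erfMonomial m a b c σ ≤ g σ) : IntegrableOn (erfMonomial m a b c) (Ioi 0) :=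
    hg.mono' ((continuousOn_erfMonomial m a b c).aestronglyMeasurable measurableSet_Ioi)
      ((ae_restrict_mem measurableSet_Ioi).mono fun σ hσ => by
        rw [norm_of_nonneg (erfMonomial_nonneg m a b c hσ)]
        exact hle σ hσ)
  rcases h' with hm | hc
  · exact of_le (integrableOn_min_one_inv_pow hm) fun σ hσ => erfMonomial_le c h hσ
  · obtain ⟨c, rfl⟩ := Nat.exists_eq_succ_of_ne_zero hc
    refine of_le (integrable_exp_neg_mul_sq one_pos).integrableOn fun σ hσ => ?_
    have hone : erfMonomial m a b c σ ≤ 1 :=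
      (erfMonomial_le c h hσ).trans (pow_le_one₀ (by positivity) (min_le_left _ _))
    calc erfMonomial m a b (c + 1) σ = erfMonomial m a b c σ * exp (-1 * σ ^ 2) := by
          rw [neg_one_mul, erfMonomial, erfMonomial, pow_succ]
          ring
      _ ≤ exp (-1 * σ ^ 2) := mul_le_of_le_one_left (exp_pos _).le hone

theorem tendsto_erfMonomial_atTop {m a b : ℕ} (c : ℕ) (h : m + 1 ≤ a + 2 * b) :
    Tendsto (erfMonomial (m + 1) a b c) atTop (𝓝 0) := by
  refine squeeze_zero' ?_ ?_ tendsto_inv_atTop_zero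
  · filter_upwards [eventually_gt_atTop 0] with σ hσ using erfMonomial_nonneg _ _ _ _ hσ
  · filter_upwards [eventually_gt_atTop 0] with σ hσ
    calc erfMonomial (m + 1) a b c σ ≤ min 1 σ⁻¹ ^ (m + 1) := erfMonomial_le c h hσ
      _ ≤ min 1 σ⁻¹ := pow_le_of_le_one (by positivity) (min_le_left _ _) m.succ_ne_zero
      _ ≤ σ⁻¹ := min_le_right _ _

theorem tendsto_erfMonomial_nhdsGT_zero {m a b : ℕ} (c : ℕ) (h : m + 1 ≤ a + 2 * b) :
    Tendsto (erfMonomial m a b c) (𝓝[>] 0) (𝓝 0) := by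
  refine squeeze_zero' (g := fun σ => σ) ?_ ?_ (tendsto_nhdsWithin_of_tendsto_nhds tendsto_id)
  · filter_upwards [self_mem_nhdsWithin] with σ hσ using erfMonomial_nonneg _ _ _ _ hσ
  · filter_upwards [self_mem_nhdsWithin] with σ (hσ : 0 < σ)
    calc erfMonomial m a b c σ = σ * erfMonomial (m + 1) a b c σ := by
          simp only [erfMonomial, pow_succ]
          field_simp
      _ ≤ σ * min 1 σ⁻¹ ^ (m + 1) := by gcongr; exact erfMonomial_le c h hσ
      _ ≤ σ := mul_le_of_le_one_right hσ.le (pow_le_one₀ (by positivity) (min_le_left _ _))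

theorem hasDerivAt_erfMonomial (m a b c : ℕ) (hσ : σ ≠ 0) :
    HasDerivAt (erfMonomial (m + 1) a b c)
      (a * erfMonomial (m + 1) (a - 1) b (c + 1) σ + 2 * b * erfMonomial m a (b - 1) (c + 1) σ
        - 2 * c * erfMonomial m a b c σ - (m + 1) * erfMonomial (m + 2) a b c σ) σ := by
  have hinv : HasDerivAt (fun σ : ℝ => σ⁻¹ ^ (m + 1)) (-(m + 1) * σ⁻¹ ^ (m + 2)) σ := by
    refine ((hasDerivAt_inv hσ).pow (m + 1)).congr_deriv ?_
    rw [Nat.cast_succ, add_tsub_cancel_right, ← inv_pow]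
    ring
  have hexp : HasDerivAt (fun σ : ℝ => exp (-σ ^ 2)) (-2 * σ * exp (-σ ^ 2)) σ := by
    refine (hasDerivAt_pow 2 σ).neg.exp.congr_deriv ?_
    simp only [Pi.neg_apply, Nat.cast_ofNat, Nat.add_one_sub_one, pow_one, mul_neg, neg_mul,
      neg_inj]
    ring
  refine (((hinv.mul ((hasDerivAt_Erf σ).pow a)).mul ((hexp.const_sub 1).pow b)).mul
    (hexp.pow c)).congr_deriv ?_
  simp only [erfMonomial, Pi.mul_apply, Pi.pow_apply]
  have hc : (c : ℝ) * exp (-σ ^ 2) ^ (c - 1) * exp (-σ ^ 2) = c * exp (-σ ^ 2) ^ c := by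
    rcases c with _ | c <;> simp [pow_succ, mul_assoc]
  have hm : σ⁻¹ ^ (m + 1) * σ = σ⁻¹ ^ m := by
    rw [pow_succ, mul_assoc, inv_mul_cancel₀ hσ, mul_one]
  rw [← hm]
  linear_combination
    (-2 * σ * σ⁻¹ ^ (m + 1) * Erf σ ^ a * (1 - exp (-σ ^ 2)) ^ b) * hc

theorem erfMoment_reduction {m a b : ℕ} (c : ℕ) (h : m + 2 ≤ a + 2 * b) :
    (m + 1) * erfMoment (m + 2) a b c =
      a * erfMoment (m + 1) (a - 1) b (c + 1) + 2 * b * erfMoment m a (b - 1) (c + 1)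
        - 2 * c * erfMoment m a b c := by
  have hErf : IntegrableOn
      (fun σ => a * erfMonomial (m + 1) (a - 1) b (c + 1) σ) (Ioi 0) := by
    rcases a.eq_zero_or_pos with rfl | ha
    · simp
    · exact (integrableOn_erfMonomial (by omega) (.inr c.succ_ne_zero)).const_mul _
  have hsub : IntegrableOn
      (fun σ => 2 * b * erfMonomial m a (b - 1) (c + 1) σ) (Ioi 0) := by
    rcases b.eq_zero_or_pos with rfl | hb
    · simp
    · exact (integrableOn_erfMonomial (by omega) (.inr c.succ_ne_zero)).const_mul _
  have hexp : IntegrableOn (fun σ => 2 * c * erfMonomial m a b c σ) (Ioi 0) := by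
    rcases c.eq_zero_or_pos with rfl | hc
    · simp
    · exact (integrableOn_erfMonomial (by omega) (.inr hc.ne')).const_mul _
  have hinv : IntegrableOn (fun σ => (m + 1) * erfMonomial (m + 2) a b c σ) (Ioi 0) :=
    (integrableOn_erfMonomial h (.inl (by omega))).const_mul _
  have hadd : IntegrableOn (fun σ => a * erfMonomial (m + 1) (a - 1) b (c + 1) σ
      + 2 * b * erfMonomial m a (b - 1) (c + 1) σ) (Ioi 0) := hErf.add hsub
  have hdiff : IntegrableOn (fun σ => a * erfMonomial (m + 1) (a - 1) b (c + 1) σ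
      + 2 * b * erfMonomial m a (b - 1) (c + 1) σ - 2 * c * erfMonomial m a b c σ) (Ioi 0) :=
    hadd.sub hexp
  have hzero : erfMonomial (m + 1) a b c 0 = 0 := by simp [erfMonomial]
  have hparts := integral_Ioi_of_hasDerivAt_of_tendsto (f := erfMonomial (m + 1) a b c)
    (by rw [← continuousWithinAt_Ioi_iff_Ici, ContinuousWithinAt, hzero]
        exact tendsto_erfMonomial_nhdsGT_zero c h)
    (fun σ hσ => hasDerivAt_erfMonomial m a b c (ne_of_gt hσ))
    (hdiff.sub hinv) (tendsto_erfMonomial_atTop c (by omega))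
  rw [hzero, integral_sub hdiff hinv, integral_sub hadd hexp,
    integral_add hErf hsub] at hparts
  simp only [integral_const_mul] at hparts
  unfold erfMoment
  linarith

theorem erfMoment_succ_eq_sub {m a b c : ℕ} (h : m ≤ a + 2 * b) (hc : c ≠ 0) :
    erfMoment m a (b + 1) c = erfMoment m a b c - erfMoment m a b (c + 1) := by
  rw [erfMoment, erfMoment, erfMoment, ← integral_sub (integrableOn_erfMonomial h (.inr hc))
    (integrableOn_erfMonomial h (.inr c.succ_ne_zero))]
  congr 1 with σ
  simp only [erfMonomial, pow_succ]
  ring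

theorem integral_gaussianInteraction_pow {d : ℕ} (hd : 2 ≤ d) :
    ∫ σ in Ioi (0 : ℝ), gaussianInteraction σ ^ d =
      ∑ j ∈ Finset.range (d + 1),
        (-1) ^ j * 2 ^ (d - j) * d.choose j * erfMoment (d + j) (d - j) j 0 := by
  have hexpand : ∀ σ : ℝ, gaussianInteraction σ ^ d = ∑ j ∈ Finset.range (d + 1),
      (-1) ^ j * 2 ^ (d - j) * d.choose j * erfMonomial (d + j) (d - j) j 0 σ := by
    intro σ
    have hsplit : gaussianInteraction σ =
        -((1 - exp (-σ ^ 2)) * (σ⁻¹ * σ⁻¹)) + 2 * (Erf σ * σ⁻¹) := by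
      simp only [gaussianInteraction, div_eq_mul_inv]
      ring
    rw [hsplit, add_pow]
    refine Finset.sum_congr rfl fun j hj => ?_
    obtain ⟨k, rfl⟩ := Nat.exists_eq_add_of_le (Finset.mem_range_succ_iff.1 hj)
    simp only [erfMonomial, Nat.add_sub_cancel_left, neg_pow (_ * _), mul_pow, pow_add]
    ring
  simp only [hexpand]
  rw [integral_finsetSum]
  · simp only [integral_const_mul, erfMoment]
  · intro j hj
    have hj' := Finset.mem_range_succ_iff.1 hj
    exact (integrableOn_erfMonomial (by omega) (.inl (by omega))).const_mul _

theorem erfMoment_three_three_zero_one :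
    erfMoment 3 3 0 1 = 3 * erfMoment 1 1 0 3 - 6 * erfMoment 0 2 0 2 - erfMoment 1 3 0 1 := by
  have red₃₃₀₁ := erfMoment_reduction (m := 1) (a := 3) (b := 0) 1 (by norm_num)
  have red₂₂₀₂ := erfMoment_reduction (m := 0) (a := 2) (b := 0) 2 (by norm_num)
  norm_num at red₃₃₀₁ red₂₂₀₂
  linarith

theorem erfMoment_four_two_one_one :
    erfMoment 4 2 1 1 =
      8 / 3 * erfMoment 0 0 0 4 - 2 * erfMoment 0 0 0 3 + 14 / 3 * erfMoment 1 1 0 3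
        - 8 / 3 * erfMoment 1 1 0 2 + 4 / 3 * erfMoment 0 2 0 1 - 16 / 3 * erfMoment 0 2 0 2 := by
  have red₄₂₁₁ := erfMoment_reduction (m := 2) (a := 2) (b := 1) 1 (by norm_num)
  have red₃₁₁₂ := erfMoment_reduction (m := 1) (a := 1) (b := 1) 2 (by norm_num)
  have red₂₂₀₂ := erfMoment_reduction (m := 0) (a := 2) (b := 0) 2 (by norm_num)
  have red₂₂₁₁ := erfMoment_reduction (m := 0) (a := 2) (b := 1) 1 (by norm_num)
  have red₂₀₁₃ := erfMoment_reduction (m := 0) (a := 0) (b := 1) 3 (by norm_num)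
  have split₀₀₁₃ : erfMoment 0 0 1 3 = erfMoment 0 0 0 3 - erfMoment 0 0 0 4 :=
    erfMoment_succ_eq_sub (by norm_num) (by norm_num)
  have split₁₁₁₂ : erfMoment 1 1 1 2 = erfMoment 1 1 0 2 - erfMoment 1 1 0 3 :=
    erfMoment_succ_eq_sub (by norm_num) (by norm_num)
  have split₀₂₁₁ : erfMoment 0 2 1 1 = erfMoment 0 2 0 1 - erfMoment 0 2 0 2 :=
    erfMoment_succ_eq_sub (by norm_num) (by norm_num)
  norm_num at red₄₂₁₁ red₃₁₁₂ red₂₂₀₂ red₂₂₁₁ red₂₀₁₃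
  linarith

theorem erfMoment_five_one_two_one :
    erfMoment 5 1 2 1 =
      7 / 3 * erfMoment 0 0 0 2 - 12 * erfMoment 0 0 0 3 + 34 / 3 * erfMoment 0 0 0 4
        + 1 / 2 * erfMoment 1 1 0 1 - 4 * erfMoment 1 1 0 2 + 9 / 2 * erfMoment 1 1 0 3 := by
  have red₅₁₂₁ := erfMoment_reduction (m := 3) (a := 1) (b := 2) 1 (by norm_num)
  have red₃₁₁₂ := erfMoment_reduction (m := 1) (a := 1) (b := 1) 2 (by norm_num)
  have red₃₁₂₁ := erfMoment_reduction (m := 1) (a := 1) (b := 2) 1 (by norm_num)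
  have red₄₀₂₂ := erfMoment_reduction (m := 2) (a := 0) (b := 2) 2 (by norm_num)
  have red₂₀₁₃ := erfMoment_reduction (m := 0) (a := 0) (b := 1) 3 (by norm_num)
  have red₂₀₂₂ := erfMoment_reduction (m := 0) (a := 0) (b := 2) 2 (by norm_num)
  have split₀₀₁₂ : erfMoment 0 0 1 2 = erfMoment 0 0 0 2 - erfMoment 0 0 0 3 :=
    erfMoment_succ_eq_sub (by norm_num) (by norm_num)
  have split₀₀₁₃ : erfMoment 0 0 1 3 = erfMoment 0 0 0 3 - erfMoment 0 0 0 4 :=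
    erfMoment_succ_eq_sub (by norm_num) (by norm_num)
  have split₀₀₂₂ : erfMoment 0 0 2 2 = erfMoment 0 0 1 2 - erfMoment 0 0 1 3 :=
    erfMoment_succ_eq_sub (by norm_num) (by norm_num)
  have split₁₁₁₁ : erfMoment 1 1 1 1 = erfMoment 1 1 0 1 - erfMoment 1 1 0 2 :=
    erfMoment_succ_eq_sub (by norm_num) (by norm_num)
  have split₁₁₁₂ : erfMoment 1 1 1 2 = erfMoment 1 1 0 2 - erfMoment 1 1 0 3 :=
    erfMoment_succ_eq_sub (by norm_num) (by norm_num)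
  have split₁₁₂₁ : erfMoment 1 1 2 1 = erfMoment 1 1 1 1 - erfMoment 1 1 1 2 :=
    erfMoment_succ_eq_sub (by norm_num) (by norm_num)
  norm_num at red₅₁₂₁ red₃₁₁₂ red₃₁₂₁ red₄₀₂₂ red₂₀₁₃ red₂₀₂₂
  linarith

theorem erfMoment_six_zero_three_one :
    erfMoment 6 0 3 1 =
      -(8 / 15) * erfMoment 0 0 0 1 + 64 / 5 * erfMoment 0 0 0 2 - 216 / 5 * erfMoment 0 0 0 3
        + 512 / 15 * erfMoment 0 0 0 4 := by
  have red₆₀₃₁ := erfMoment_reduction (m := 4) (a := 0) (b := 3) 1 (by norm_num)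
  have red₄₀₂₂ := erfMoment_reduction (m := 2) (a := 0) (b := 2) 2 (by norm_num)
  have red₄₀₃₁ := erfMoment_reduction (m := 2) (a := 0) (b := 3) 1 (by norm_num)
  have red₂₀₁₃ := erfMoment_reduction (m := 0) (a := 0) (b := 1) 3 (by norm_num)
  have red₂₀₂₂ := erfMoment_reduction (m := 0) (a := 0) (b := 2) 2 (by norm_num)
  have red₂₀₃₁ := erfMoment_reduction (m := 0) (a := 0) (b := 3) 1 (by norm_num)
  have split₀₀₁₁ : erfMoment 0 0 1 1 = erfMoment 0 0 0 1 - erfMoment 0 0 0 2 :=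
    erfMoment_succ_eq_sub (by norm_num) (by norm_num)
  have split₀₀₁₂ : erfMoment 0 0 1 2 = erfMoment 0 0 0 2 - erfMoment 0 0 0 3 :=
    erfMoment_succ_eq_sub (by norm_num) (by norm_num)
  have split₀₀₁₃ : erfMoment 0 0 1 3 = erfMoment 0 0 0 3 - erfMoment 0 0 0 4 :=
    erfMoment_succ_eq_sub (by norm_num) (by norm_num)
  have split₀₀₂₁ : erfMoment 0 0 2 1 = erfMoment 0 0 1 1 - erfMoment 0 0 1 2 :=
    erfMoment_succ_eq_sub (by norm_num) (by norm_num)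
  have split₀₀₂₂ : erfMoment 0 0 2 2 = erfMoment 0 0 1 2 - erfMoment 0 0 1 3 :=
    erfMoment_succ_eq_sub (by norm_num) (by norm_num)
  have split₀₀₃₁ : erfMoment 0 0 3 1 = erfMoment 0 0 2 1 - erfMoment 0 0 2 2 :=
    erfMoment_succ_eq_sub (by norm_num) (by norm_num)
  norm_num at red₆₀₃₁ red₄₀₂₂ red₄₀₃₁ red₂₀₁₃ red₂₀₂₂ red₂₀₃₁
  linarith

theorem integral_gaussianInteraction_pow_four :
    ∫ σ in Ioi (0 : ℝ), gaussianInteraction σ ^ 4 =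
      32 / 315 * erfMoment 0 0 0 1 + 136 / 105 * erfMoment 0 0 0 2 - 48 / 35 * erfMoment 0 0 0 3
        - 368 / 315 * erfMoment 0 0 0 4 - 32 / 5 * erfMoment 0 2 0 1 - 32 / 5 * erfMoment 0 2 0 2
        + 4 / 5 * erfMoment 1 1 0 1 + 32 / 5 * erfMoment 1 1 0 2 + 4 / 5 * erfMoment 1 1 0 3
        - 16 / 3 * erfMoment 1 3 0 1 := by
  have red₄₄₀₀ := erfMoment_reduction (m := 2) (a := 4) (b := 0) 0 (by norm_num)
  have red₅₃₁₀ := erfMoment_reduction (m := 3) (a := 3) (b := 1) 0 (by norm_num)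
  have red₆₂₂₀ := erfMoment_reduction (m := 4) (a := 2) (b := 2) 0 (by norm_num)
  have red₇₁₃₀ := erfMoment_reduction (m := 5) (a := 1) (b := 3) 0 (by norm_num)
  have red₈₀₄₀ := erfMoment_reduction (m := 6) (a := 0) (b := 4) 0 (by norm_num)
  have hchoose : Nat.choose 4 2 = 6 ∧ Nat.choose 4 3 = 4 := by decide
  rw [integral_gaussianInteraction_pow (by norm_num)]
  simp only [Finset.sum_range_succ, Finset.sum_range_zero, hchoose.1, hchoose.2]
  norm_num at red₄₄₀₀ red₅₃₁₀ red₆₂₂₀ red₇₁₃₀ red₈₀₄₀ ⊢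
  linarith [erfMoment_three_three_zero_one, erfMoment_four_two_one_one,
    erfMoment_five_one_two_one, erfMoment_six_zero_three_one]

/-! ### Evaluation of the irreducible moments -/

theorem integral_exp_neg_mul_sq_Ioi (k : ℝ) :
    ∫ σ in Ioi (0 : ℝ), exp (-k * σ ^ 2) = √π / 2 * (√k)⁻¹ := by
  rw [integral_gaussian_Ioi, sqrt_div pi_pos.le]
  ring

theorem integral_mul_Erf {w : ℝ → ℝ} (hw : IntegrableOn (fun σ => w σ * σ) (Ioi 0)) :
    ∫ σ in Ioi (0 : ℝ), w σ * Erf σ =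
      ∫ t in (0 : ℝ)..1, ∫ σ in Ioi (0 : ℝ), w σ * σ * exp (-(t * σ) ^ 2) := by
  simp only [Erf_eq_mul_integral, ← mul_assoc]
  simp only [intervalIntegral.integral_of_le zero_le_one, ← integral_const_mul]
  refine integral_integral_swap (Integrable.mono' (hw.norm.mul_prod (integrable_const 1))
    (hw.aestronglyMeasurable.comp_fst.mul (by fun_prop)) (ae_of_all _ fun p => ?_))
  rw [Function.uncurry, norm_mul, norm_of_nonneg (exp_pos _).le]
  gcongr
  exact exp_le_one_iff.2 (neg_nonpos.2 (sq_nonneg _))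

theorem integral_inv_sqrt_add_sq {k : ℝ} (hk : 0 < k) (a b : ℝ) :
    ∫ t in a..b, (√(k + t ^ 2))⁻¹ = arsinh (b / √k) - arsinh (a / √k) := by
  have hpos (t : ℝ) : 0 < k + t ^ 2 := by positivity
  refine intervalIntegral.integral_eq_sub_of_hasDerivAt (f := fun t => arsinh (t / √k))
    (fun t _ => ?_) (Continuous.intervalIntegrable
      (Continuous.inv₀ (by fun_prop) fun t => (sqrt_pos.2 (hpos t)).ne') _ _)
  refine ((hasDerivAt_id t).div_const (√k)).arsinh.congr_deriv ?_
  have hone : 1 + (t / √k) ^ 2 = (k + t ^ 2) / k := by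
    rw [div_pow, sq_sqrt hk.le]
    field_simp
  rw [id, hone, smul_eq_mul, sqrt_div (hpos t).le]
  field_simp

theorem integral_inv_add_sq_mul_sqrt {k : ℝ} (hk : 0 < k) (a b : ℝ) :
    ∫ t in a..b, ((k + t ^ 2) * √(k + 1 + t ^ 2))⁻¹ =
      (√k)⁻¹ * arctan (b / (√k * √(k + 1 + b ^ 2)))
        - (√k)⁻¹ * arctan (a / (√k * √(k + 1 + a ^ 2))) := by
  have hpos (t : ℝ) : 0 < k + 1 + t ^ 2 := by positivity
  refine intervalIntegral.integral_eq_sub_of_hasDerivAt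
    (f := fun t => (√k)⁻¹ * arctan (t / (√k * √(k + 1 + t ^ 2))))
    (fun t _ => ?_) (Continuous.intervalIntegrable
      (Continuous.inv₀ (by fun_prop) fun t => by positivity) _ _)
  have hr : √k ^ 2 = k := sq_sqrt hk.le
  have hs : √(k + 1 + t ^ 2) ^ 2 = k + 1 + t ^ 2 := sq_sqrt (hpos t).le
  have hquad : HasDerivAt (fun t : ℝ => k + 1 + t ^ 2) (2 * t) t := by
    simpa using (hasDerivAt_pow 2 t).const_add (k + 1)
  refine (((hasDerivAt_id t).div ((hquad.sqrt (hpos t).ne').const_mul (√k))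
    (by positivity)).arctan.const_mul (√k)⁻¹).congr_deriv ?_
  have hone : 1 + (t / (√k * √(k + 1 + t ^ 2))) ^ 2 =
      (k + 1) * (k + t ^ 2) / (√k * √(k + 1 + t ^ 2)) ^ 2 := by
    rw [div_pow, mul_pow, hr, hs]
    field_simp
    ring
  have hquot : 1 * (√k * √(k + 1 + t ^ 2)) - t * (√k * (2 * t / (2 * √(k + 1 + t ^ 2)))) =
      (k + 1) * √k / √(k + 1 + t ^ 2) := by
    field_simp
    rw [hs]
    ring
  simp only [id, Pi.div_apply]
  rw [hone, hquot]
  field_simp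

theorem integral_inv_mul_Erf_mul_exp {k : ℝ} (hk : 0 < k) :
    ∫ σ in Ioi (0 : ℝ), σ⁻¹ * exp (-k * σ ^ 2) * Erf σ = √π / 2 * arsinh (√k)⁻¹ := by
  have hcancel : EqOn (fun σ : ℝ => exp (-k * σ ^ 2)) (fun σ => σ⁻¹ * exp (-k * σ ^ 2) * σ)
      (Ioi 0) := fun σ (hσ : 0 < σ) => by field_simp
  have hinner (t : ℝ) : ∫ σ in Ioi (0 : ℝ), σ⁻¹ * exp (-k * σ ^ 2) * σ * exp (-(t * σ) ^ 2) =
      √π / 2 * (√(k + t ^ 2))⁻¹ := by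
    rw [← integral_exp_neg_mul_sq_Ioi]
    refine setIntegral_congr_fun measurableSet_Ioi fun σ hσ => ?_
    simp only [← hcancel hσ, ← exp_add]
    ring_nf
  rw [integral_mul_Erf
    ((integrable_exp_neg_mul_sq hk).integrableOn.congr_fun hcancel measurableSet_Ioi)]
  simp only [hinner]
  rw [intervalIntegral.integral_const_mul, integral_inv_sqrt_add_sq hk]
  simp

theorem integrableOn_Erf_mul {w : ℝ → ℝ} (hw : IntegrableOn w (Ioi 0)) :
    IntegrableOn (fun σ => Erf σ * w σ) (Ioi 0) := by
  refine Integrable.bdd_mul hw (by fun_prop)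
    ((ae_restrict_mem measurableSet_Ioi).mono fun σ hσ => ?_) (c := 1)
  rw [norm_of_nonneg (Erf_nonneg (le_of_lt hσ))]
  exact Erf_le_one σ

theorem integral_Erf_mul_exp_mul {k : ℝ} (hk : 0 < k) :
    ∫ σ in Ioi (0 : ℝ), Erf σ * (exp (-k * σ ^ 2) * σ) = √π / 4 * (k * √(k + 1))⁻¹ := by
  have hexp (σ : ℝ) :
      HasDerivAt (fun σ : ℝ => -(2 * k)⁻¹ * exp (-k * σ ^ 2)) (exp (-k * σ ^ 2) * σ) σ := by
    refine (((hasDerivAt_pow 2 σ).const_mul (-k)).exp.const_mul (-(2 * k)⁻¹)).congr_deriv ?_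
    push_cast
    field_simp
  have hprod (σ : ℝ) : exp (-σ ^ 2) * (-(2 * k)⁻¹ * exp (-k * σ ^ 2)) =
      -(2 * k)⁻¹ * exp (-(k + 1) * σ ^ 2) := by
    rw [mul_left_comm, ← exp_add]
    ring_nf
  have hmul : IntegrableOn (fun σ => exp (-k * σ ^ 2) * σ) (Ioi 0) := by
    simpa only [mul_comm] using (integrable_mul_exp_neg_mul_sq hk).integrableOn
  have hzero : Tendsto (fun σ => Erf σ * (-(2 * k)⁻¹ * exp (-k * σ ^ 2))) (𝓝[>] 0) (𝓝 0) :=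
    (Continuous.tendsto' (by fun_prop) 0 0 (by simp)).mono_left nhdsWithin_le_nhds
  have htop : Tendsto (fun σ => Erf σ * (-(2 * k)⁻¹ * exp (-k * σ ^ 2))) atTop (𝓝 0) := by
    have hdecay : Tendsto (fun σ : ℝ => exp (-k * σ ^ 2)) atTop (𝓝 0) :=
      tendsto_exp_atBot.comp
        ((tendsto_pow_atTop two_ne_zero).const_mul_atTop_of_neg (neg_lt_zero.2 hk))
    simpa using tendsto_Erf_atTop.mul (hdecay.const_mul (-(2 * k)⁻¹))
  have hparts := integral_Ioi_mul_deriv_eq_deriv_mul (fun σ _ => hasDerivAt_Erf σ)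
    (fun σ _ => hexp σ) (integrableOn_Erf_mul hmul)
    (((integrable_exp_neg_mul_sq (by positivity : 0 < k + 1)).const_mul _).integrableOn.congr_fun
      (fun σ _ => (hprod σ).symm) measurableSet_Ioi) hzero htop
  simp only [hprod, integral_const_mul, integral_exp_neg_mul_sq_Ioi] at hparts
  rw [hparts, mul_inv, mul_inv]
  ring

theorem integral_Erf_mul_exp_mul_Erf {k : ℝ} (hk : 0 < k) :
    ∫ σ in Ioi (0 : ℝ), Erf σ * exp (-k * σ ^ 2) * Erf σ =
      √π / 4 * ((√k)⁻¹ * arctan (√k * √(k + 2))⁻¹) := by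
  have hmul : IntegrableOn (fun σ => Erf σ * exp (-k * σ ^ 2) * σ) (Ioi 0) := by
    simpa only [mul_assoc, mul_comm (exp _)] using
      integrableOn_Erf_mul (integrable_mul_exp_neg_mul_sq hk).integrableOn
  have hinner (t : ℝ) : ∫ σ in Ioi (0 : ℝ), Erf σ * exp (-k * σ ^ 2) * σ * exp (-(t * σ) ^ 2) =
      √π / 4 * ((k + t ^ 2) * √(k + 1 + t ^ 2))⁻¹ := by
    rw [add_right_comm, ← integral_Erf_mul_exp_mul (by positivity)]
    congr 1 with σ
    rw [neg_add, add_mul, exp_add, mul_pow, neg_mul (t ^ 2)]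
    ring
  rw [integral_mul_Erf hmul]
  simp only [hinner]
  rw [intervalIntegral.integral_const_mul, integral_inv_add_sq_mul_sqrt hk]
  norm_num [add_assoc]

theorem erfMonomial_zero_right (m a k : ℕ) (σ : ℝ) :
    erfMonomial m a 0 k σ = σ⁻¹ ^ m * Erf σ ^ a * exp (-k * σ ^ 2) := by
  rw [erfMonomial, pow_zero, mul_one, ← exp_nat_mul, mul_neg, neg_mul]

theorem erfMoment_zero_zero_zero (k : ℕ) : erfMoment 0 0 0 k = √π / 2 * (√k)⁻¹ := by
  simp only [erfMoment, erfMonomial_zero_right, pow_zero, one_mul, integral_exp_neg_mul_sq_Ioi]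

theorem erfMoment_one_one_zero {k : ℕ} (hk : 0 < k) :
    erfMoment 1 1 0 k = √π / 2 * arsinh (√k)⁻¹ := by
  simp only [erfMoment, erfMonomial_zero_right, pow_one, mul_right_comm _ (Erf _)]
  exact integral_inv_mul_Erf_mul_exp (Nat.cast_pos.2 hk)

theorem erfMoment_zero_two_zero {k : ℕ} (hk : 0 < k) :
    erfMoment 0 2 0 k = √π / 4 * ((√k)⁻¹ * arctan (√k * √(k + 2))⁻¹) := by
  simp only [erfMoment, erfMonomial_zero_right, pow_zero, one_mul, sq (Erf _),
    mul_right_comm _ (Erf _)]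
  exact integral_Erf_mul_exp_mul_Erf (Nat.cast_pos.2 hk)

theorem arsinh_one : arsinh 1 = log (1 + √2) := by
  rw [arsinh, one_pow, one_add_one_eq_two]

theorem arsinh_inv_sqrt_two : arsinh (√2)⁻¹ = log (1 + √3) - log 2 / 2 := by
  have harg : (√2)⁻¹ + √(1 + (√2)⁻¹ ^ 2) = (1 + √3) / √2 := by
    rw [inv_pow, sq_sqrt zero_le_two, show (1 : ℝ) + 2⁻¹ = 3 / 2 by norm_num,
      sqrt_div zero_le_three]
    ring
  rw [arsinh, harg, log_div (by positivity) (by positivity), log_sqrt zero_le_two]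

theorem arsinh_inv_sqrt_three : arsinh (√3)⁻¹ = log 3 / 2 := by
  have harg : (√3)⁻¹ + √(1 + (√3)⁻¹ ^ 2) = √3 := by
    rw [inv_pow, sq_sqrt zero_le_three, show (1 : ℝ) + 3⁻¹ = 2 ^ 2 / 3 by norm_num,
      sqrt_div (by positivity), sqrt_sq zero_le_two]
    field_simp
    rw [sq_sqrt zero_le_three]
    norm_num
  rw [arsinh, harg, log_sqrt zero_le_three]

theorem toReal_selfInteraction_four :
    (selfInteraction 4).toReal =
      -(152 / 315) + 68 * √2 / 105 - 16 * √3 / 35 - 16 * log 2 / 5 + 2 * log 3 / 5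
        + 4 / 5 * log (1 + √2) + 32 / 5 * log (1 + √3) - 8 * π / 15
        - 8 * √2 / 5 * arctan (1 / (2 * √2)) - 16 / 3 * (2 / √π * erfMoment 1 3 0 1) := by
  have hpi : √π ≠ 0 := by positivity
  have hinv₂ : (√2)⁻¹ = √2 / 2 := by rw [← sqrt_div_self, div_eq_mul_inv]
  have hinv₃ : (√3)⁻¹ = √3 / 3 := by rw [← sqrt_div_self]
  have hsqrt₄ : √(4 : ℝ) = 2 := by
    rw [show (4 : ℝ) = 2 ^ 2 by norm_num, sqrt_sq zero_le_two]
  have hq₁ : erfMoment 0 2 0 1 = √π / 4 * (π / 6) := by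
    rw [erfMoment_zero_two_zero one_pos]
    norm_num [arctan_inv_sqrt_three]
  have hq₂ : erfMoment 0 2 0 2 = √π / 4 * ((√2)⁻¹ * arctan (1 / (2 * √2))) := by
    rw [erfMoment_zero_two_zero two_pos]
    norm_num [hsqrt₄, mul_comm]
  have hs₁ := erfMoment_one_one_zero one_pos
  have hs₂ := erfMoment_one_one_zero two_pos
  have hs₃ := erfMoment_one_one_zero three_pos
  norm_num [arsinh_one, arsinh_inv_sqrt_two, arsinh_inv_sqrt_three] at hs₁ hs₂ hs₃
  rw [toReal_selfInteraction (by norm_num), integral_gaussianInteraction_pow_four, hq₁, hq₂, hs₁,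
    hs₂, hs₃]
  simp only [erfMoment_zero_zero_zero, Nat.cast_ofNat, Nat.cast_one, sqrt_one, hsqrt₄]
  rw [hinv₂, hinv₃]
  field_simp
  ring

end

theorem mainTheorem7 :
    (∀ d : ℕ, 1 ≤ d →
      selfInteraction d =
        ∫⁻ σ in Ioi (0 : ℝ), ENNReal.ofReal
          (2 / √Real.pi * (2 * Erf σ / σ + (Real.exp (-σ ^ 2) - 1) / σ ^ 2) ^ d)) ∧
    selfInteraction 1 = ∞ ∧
    (∀ d : ℕ, 2 ≤ d →
      selfInteraction d < ∞ ∧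
      IntegrableOn
        (fun σ : ℝ => (2 * Erf σ / σ + (Real.exp (-σ ^ 2) - 1) / σ ^ 2) ^ d) (Ioi 0) ∧
      (selfInteraction d).toReal =
        2 / √Real.pi *
          ∫ σ in Ioi (0 : ℝ), (2 * Erf σ / σ + (Real.exp (-σ ^ 2) - 1) / σ ^ 2) ^ d) ∧
    IntegrableOn (fun σ : ℝ => σ⁻¹ * Real.exp (-σ ^ 2) * Erf σ ^ 3) (Ioi 0) ∧
    (selfInteraction 4).toReal =
      -(152 / 315) + 68 * √2 / 105 - 16 * √3 / 35 - 16 * Real.log 2 / 5 + 2 * Real.log 3 / 5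
        + 4 / 5 * Real.log (1 + √2) + 32 / 5 * Real.log (1 + √3) - 8 * Real.pi / 15
        - 8 * √2 / 5 * Real.arctan (1 / (2 * √2))
        - 16 / 3 * (2 / √Real.pi *
            ∫ σ in Ioi (0 : ℝ), σ⁻¹ * Real.exp (-σ ^ 2) * Erf σ ^ 3) := by
  have hmonomial : erfMonomial 1 3 0 1 = fun σ => σ⁻¹ * Real.exp (-σ ^ 2) * Erf σ ^ 3 := by
    ext σ
    rw [erfMonomial]
    ring
  refine ⟨fun d _ => selfInteraction_eq_lintegral d, selfInteraction_one, fun d hd => ⟨?_,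
    integrableOn_gaussianInteraction_pow hd, toReal_selfInteraction hd⟩, ?_, ?_⟩
  · rw [selfInteraction_eq_ofReal hd]
    exact ENNReal.ofReal_lt_top
  · rw [← hmonomial]
    exact integrableOn_erfMonomial (by norm_num) (.inr one_ne_zero)
  · rw [← hmonomial]
    exact toReal_selfInteraction_four
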